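/- Notation. For $f:\mathbb{R}^n\to(-\infty,\infty]$, ${\rm dom}\,f=\{x: f(x)<\infty\}$; $f$ is \emph{proper} if it never equals $-\infty$ and ${\rm dom}\,f\neq\emptyset$, \emph{closed} if it is lower semicontinuous, and \emph{polyhedral} if its epigraph $\{(x,t)\in\mathbb{R}^n\times\mathbb{R}: f(x)\le t\}$ is a finite intersection of closed half-spaces. For $x\in{\rm dom}\,f$ let $\widehat\partial f(x)$ be the set of $v$ with $\liminf_{z\to x,\,z\ne x}\frac{f(z)-f(x)-\langle v,z-x\rangle}{\|z-x\|}\ge 0$, and let $\partial f(x)$ be the set of limits $v=\lim_t v^t$ with $v^t\in\widehat\partial f(x^t)$, $x^t\to x$, $f(x^t)\to f(x)$; both are empty for $x\notin{\rm dom}\,f$. Put ${\rm dom}\,\partial f=\{x:\partial f(x)\ne\emptyset\}$ and ${\rm dist}(0,\emptyset)=\infty$. A proper closed function $f$ is a \emph{KL function} if for each $\bar x\in{\rm dom}\,\partial f$ there are a neighbourhood $\mathcal N$ of $\bar x$, $\nu\in(0,\infty]$ and a continuous concave $\psi:[0,\nu)\to\mathbb{R}_+$ with $\psi(0)=0$,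 continuously differentiable on $(0,\nu)$ with $\psi'>0$, such that $\psi'(f(x)-f(\bar x))\,{\rm dist}(0,\partial f(x))\ge 1$ for all $x\in\mathcal N$ with $f(\bar x)<f(x)<f(\bar x)+\nu$. For $\alpha\in[0,1)$, $f$ is a \emph{KL function with an exponent of $\alpha$} if it is a KL function and for each $\bar x\in{\rm dom}\,\partial f$ there are $c,\epsilon>0$ and $\nu\in(0,\infty]$ with ${\rm dist}(0,\partial f(x))\ge c\,(f(x)-f(\bar x))^{\alpha}$ whenever $\|x-\bar x\|\le\epsilon$ and $f(\bar x)<f(x)<f(\bar x)+\nu$. Statement. (a) Let $r\ge1$ and $$f(x)=\min_{1\le i\le r}\left\{\tfrac12x^TM_ix+u_i^Tx+\beta_i+P_i(x)\right\},\qquad x\in\mathbb{R}^n,$$ where the $M_i\in\mathbb{R}^{n\times n}$ are symmetric (possibly indefinite), $u_i\in\mathbb{R}^n$, $\beta_i\in\mathbb{R}$, and the $P_i:\mathbb{R}^n\to(-\infty,\infty]$ are proper closed polyhedral functions. If $f$ is continuous on ${\rm dom}\,\partial f$ (that is, the restriction of $f$ to ${\rm dom}\,\partial f$ is continuous), then $f$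 is a KL function with an exponent of $\frac12$. (b) Let $A\in\mathbb{R}^{m\times n}$, $b\in\mathbb{R}^m$ and $f(x)=\frac12\|Ax-b\|^2+\sum_{i=1}^n\rho(x_i)$, where $\rho$ is either the SCAD penalty with parameters $\lambda>0$, $\theta>2$, $$\rho(t)=\begin{cases}\lambda|t| & |t|\le\lambda,\\ \frac{-t^2+2\theta\lambda|t|-\lambda^2}{2(\theta-1)} & \lambda<|t|\le\theta\lambda,\\ \frac{(\theta+1)\lambda^2}{2} & |t|>\theta\lambda,\end{cases}$$ or the MCP penalty with parameters $\lambda>0$, $\theta>0$, $$\rho(t)=\begin{cases}\lambda|t|-\frac{t^2}{2\theta} & |t|\le\theta\lambda,\\ \frac{\theta\lambda^2}{2} & |t|>\theta\lambda.\end{cases}$$ Then $f$ is a KL function with an exponent of $\frac12$. -/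

import Mathlib

open Filter Topology
open scoped Matrix

noncomputable section

namespace KL

/-! Extended-real-valued functions and their subdifferentials -/

section Subdifferential

variable {E : Type*} [NormedAddCommGroup E] [InnerProductSpace ℝ E]

/-- The effective domain of an extended-real-valued function. -/
def dom (f : E → EReal) : Set E := {x | f x < ⊤}

/-- A function is proper if it never takes the value `-∞` and its domain is nonempty. -/
def IsProper (f : E → EReal) : Prop := (∀ x, f x ≠ ⊥) ∧ (dom f).Nonempty

/-- A function is closed if it is lower semicontinuous. -/
def IsClosedFun (f : E → EReal) : Prop := LowerSemicontinuous f

/-- The regular (Fréchet) subdifferential; it is empty outside the domain. -/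
def regularSubdiff (f : E → EReal) (x : E) : Set E :=
  {v | x ∈ dom f ∧
    0 ≤ liminf (fun z : E => (f z - f x - ((inner ℝ v (z - x) : ℝ) : EReal)) /
      ((‖z - x‖ : ℝ) : EReal)) (𝓝[≠] x)}

/-- The limiting subdifferential; it is empty outside the domain. -/
def subdiff (f : E → EReal) (x : E) : Set E :=
  {v | x ∈ dom f ∧ ∃ (y : ℕ → E) (w : ℕ → E),
    Tendsto y atTop (𝓝 x) ∧ Tendsto (fun t => f (y t)) atTop (𝓝 (f x)) ∧
    Tendsto w atTop (𝓝 v) ∧ ∀ t, w t ∈ regularSubdiff f (y t)}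

/-- The domain of the limiting subdifferential. -/
def domSubdiff (f : E → EReal) : Set E := {x | (subdiff f x).Nonempty}

/-- The Kurdyka–Łojasiewicz property of `f` at `xbar`. The distance from `0` to the
subdifferential is extended-valued, so that it is `∞` when the subdifferential is empty. -/
def HasKLProperty (f : E → EReal) (xbar : E) : Prop :=
  xbar ∈ domSubdiff f ∧
  ∃ N ∈ 𝓝 xbar, ∃ ν : EReal, 0 < ν ∧ ∃ ψ : ℝ → ℝ,
    ContinuousOn ψ {s : ℝ | 0 ≤ s ∧ (s : EReal) < ν} ∧
    ConcaveOn ℝ {s : ℝ | 0 ≤ s ∧ (s : EReal) < ν} ψ ∧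
    (∀ s : ℝ, 0 ≤ s → (s : EReal) < ν → 0 ≤ ψ s) ∧
    ψ 0 = 0 ∧
    ContDiffOn ℝ 1 ψ {s : ℝ | 0 < s ∧ (s : EReal) < ν} ∧
    (∀ s : ℝ, 0 < s → (s : EReal) < ν → 0 < deriv ψ s) ∧
    ∀ x ∈ N, f xbar < f x → f x < f xbar + ν →
      1 ≤ ENNReal.ofReal (deriv ψ (f x - f xbar).toReal) *
        Metric.infEDist 0 (subdiff f x)

/-- A KL function: a proper closed function with the KL property at every point of the
domain of its subdifferential. -/
def IsKLFunction (f : E → EReal) : Prop :=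
  IsProper f ∧ IsClosedFun f ∧ ∀ xbar ∈ domSubdiff f, HasKLProperty f xbar

/-- The KL inequality at `xbar` with exponent `α`. -/
def HasKLExponentAt (f : E → EReal) (α : ℝ) (xbar : E) : Prop :=
  xbar ∈ domSubdiff f ∧
  ∃ c : ℝ, 0 < c ∧ ∃ ε : ℝ, 0 < ε ∧ ∃ ν : EReal, 0 < ν ∧
    ∀ x : E, ‖x - xbar‖ ≤ ε → f xbar < f x → f x < f xbar + ν →
      ENNReal.ofReal (c * (f x - f xbar).toReal ^ α) ≤ Metric.infEDist 0 (subdiff f x)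

/-- `f` is a KL function with an exponent of `α`. -/
def IsKLFunctionWithExponent (f : E → EReal) (α : ℝ) : Prop :=
  0 ≤ α ∧ α < 1 ∧ IsKLFunction f ∧ ∀ xbar ∈ domSubdiff f, HasKLExponentAt f α xbar

/-- A polyhedral set: the intersection of finitely many closed half-spaces. -/
def IsPolyhedralSet {V : Type*} [AddCommGroup V] [Module ℝ V] (S : Set V) : Prop :=
  ∃ (k : ℕ) (φ : Fin k → V →ₗ[ℝ] ℝ) (b : Fin k → ℝ), S = {z | ∀ j, φ j z ≤ b j}

/-- A polyhedral function: its epigraph is a polyhedral set. -/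
def IsPolyhedralFun (P : E → EReal) : Prop :=
  IsPolyhedralSet {p : E × ℝ | P p.1 ≤ (p.2 : EReal)}

end Subdifferential

/-- The quadratic function `½ xᵀ M x + uᵀ x + β`. -/
def quad {n : ℕ} (M : Matrix (Fin n) (Fin n) ℝ) (u : EuclideanSpace ℝ (Fin n)) (β : ℝ)
    (x : EuclideanSpace ℝ (Fin n)) : ℝ :=
  (1 / 2 : ℝ) * (x.ofLp ⬝ᵥ (M *ᵥ x.ofLp)) + u.ofLp ⬝ᵥ x.ofLp + β

/-- The pointwise minimum of the functions `½ xᵀ Mᵢ x + uᵢᵀ x + βᵢ + Pᵢ(x)`. -/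
def minQuadPlus {n r : ℕ} (M : Fin r → Matrix (Fin n) (Fin n) ℝ)
    (u : Fin r → EuclideanSpace ℝ (Fin n)) (β : Fin r → ℝ)
    (P : Fin r → EuclideanSpace ℝ (Fin n) → EReal) (x : EuclideanSpace ℝ (Fin n)) : EReal :=
  ⨅ i, ((quad (M i) (u i) (β i) x : ℝ) : EReal) + P i x

/-- The SCAD penalty with parameters `lam` and `θ`. -/
def scad (lam θ t : ℝ) : ℝ :=
  if |t| ≤ lam then lam * |t|
  else if |t| ≤ θ * lam then (-t ^ 2 + 2 * θ * lam * |t| - lam ^ 2) / (2 * (θ - 1))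
  else (θ + 1) * lam ^ 2 / 2

/-- The MCP penalty with parameters `lam` and `θ`. -/
def mcp (lam θ t : ℝ) : ℝ :=
  if |t| ≤ θ * lam then lam * |t| - t ^ 2 / (2 * θ)
  else θ * lam ^ 2 / 2

/-- The regularized least squares objective `½ ‖A x - b‖² + ∑ᵢ ρ(xᵢ)`, with the Euclidean
norm on `ℝᵐ`, as an extended-real-valued function. -/
def regLeastSquares {m n : ℕ} (A : Matrix (Fin m) (Fin n) ℝ) (b : EuclideanSpace ℝ (Fin m))
    (ρ : ℝ → ℝ) (x : EuclideanSpace ℝ (Fin n)) : EReal :=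
  (((1 / 2 : ℝ) * ‖WithLp.toLp 2 (A *ᵥ x.ofLp) - b‖ ^ 2 + ∑ i, ρ (x i) : ℝ) : EReal)

end KL

end

/-! Both kinds of function have an epigraph that is a finite union of polyhedra in `E × ℝ`, each
sheared by a quadratic `q i`: `f x ≤ t` iff `(x, t - q i x)` lies in some piece. Subtracting `q i`
straightens a piece, and its active constraints then span a linear picture: along directions
annihilated by all of them, `f` lies below a quadratic, so a subgradient must agree with the
gradient of that quadratic (`inner_eq_of_mem_regularSubdiff`). This survives limits because there
are finitely many pieces (`exists_inner_eq_of_mem_subdiff`).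

Near a base point `(x₀, t₀)`, every constraint active at `(x, t)` is also tight at the base point,
so the sheared displacement lies in that annihilated subspace. There `t - t₀` is a quadratic in the
displacement, with gradient represented by the subgradient `v`. The exponent `1/2` inequality for
quadratics on a subspace (`exists_quadratic_le_mul_sq`) gives `t - t₀ ≤ C * ‖v‖ ^ 2`. Finitely many
pairs of piece and active set make the constants uniform. -/

namespace KL

/-! ### Quadratic functions and their Łojasiewicz inequality on subspaces -/

section Quadratic

variable {E : Type*} [NormedAddCommGroup E] [InnerProductSpace ℝ E]

/-- A quadratic function with (symmetric) Hessian `M` and gradient `u` at the origin. -/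
def IsQuadraticWith (q : E → ℝ) (M : E →ₗ[ℝ] E) (u : E) : Prop :=
  M.IsSymmetric ∧ ∃ β : ℝ, ∀ x, q x = (1 / 2) * inner ℝ (M x) x + inner ℝ u x + β

/-- A quadratic function on an inner product space. -/
def IsQuadratic (q : E → ℝ) : Prop := ∃ M u, IsQuadraticWith q M u

theorem IsQuadraticWith.expand {q : E → ℝ} {M : E →ₗ[ℝ] E} {u : E} (h : IsQuadraticWith q M u)
    (x d : E) :
    q (x + d) = q x + inner ℝ (M x + u) d + (1 / 2) * inner ℝ (M d) d := by
  obtain ⟨hM, β, hq⟩ := h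
  have h1 : inner ℝ (M d) x = inner ℝ (M x) d := by
    rw [hM d x, real_inner_comm]
  simp only [hq, map_add, inner_add_left, inner_add_right, h1]
  ring

theorem IsQuadraticWith.continuous [FiniteDimensional ℝ E] {q : E → ℝ} {M : E →ₗ[ℝ] E} {u : E}
    (h : IsQuadraticWith q M u) : Continuous q := by
  obtain ⟨hM, β, hq⟩ := h
  have hc : Continuous M := M.continuous_of_finiteDimensional
  rw [funext hq]
  fun_prop

theorem IsQuadratic.const (c : ℝ) : IsQuadratic fun _ : E => c :=
  ⟨0, 0, LinearMap.IsSymmetric.zero, c, by simp⟩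

theorem IsQuadratic.linear (u : E) : IsQuadratic fun x : E => inner ℝ u x :=
  ⟨0, u, LinearMap.IsSymmetric.zero, 0, by simp⟩

theorem IsQuadratic.add {p q : E → ℝ} (hp : IsQuadratic p) (hq : IsQuadratic q) :
    IsQuadratic fun x => p x + q x := by
  obtain ⟨M, u, hM, β, hp⟩ := hp
  obtain ⟨N, w, hN, γ, hq⟩ := hq
  refine ⟨M + N, u + w, hM.add hN, β + γ, fun x => ?_⟩
  simp only [hp, hq, LinearMap.add_apply, inner_add_left]
  ring

theorem IsQuadratic.const_mul {p : E → ℝ} (hp : IsQuadratic p) (c : ℝ) :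
    IsQuadratic fun x => c * p x := by
  obtain ⟨M, u, hM, β, hp⟩ := hp
  refine ⟨c • M, c • u, fun x y => ?_, c * β, fun x => ?_⟩
  · simp only [LinearMap.smul_apply, real_inner_smul_left, real_inner_smul_right, hM x y]
  · simp only [hp, LinearMap.smul_apply, real_inner_smul_left]
    ring

theorem IsQuadratic.sum {ι : Type*} (s : Finset ι) {p : ι → E → ℝ}
    (hp : ∀ i, IsQuadratic (p i)) : IsQuadratic fun x => ∑ i ∈ s, p i x := by
  classical
  induction s using Finset.induction_on with
  | empty => simpa using IsQuadratic.const 0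
  | insert i s hi ih => simpa only [Finset.sum_insert hi] using (hp i).add ih

theorem IsQuadratic.norm_sub_sq {F : Type*} [NormedAddCommGroup F] [InnerProductSpace ℝ F]
    [FiniteDimensional ℝ E] [FiniteDimensional ℝ F] (A : E →ₗ[ℝ] F) (b : F) :
    IsQuadratic fun x => ‖A x - b‖ ^ 2 := by
  refine ⟨(2 : ℝ) • (A.adjoint ∘ₗ A), (-2 : ℝ) • A.adjoint b, fun x y => ?_, ‖b‖ ^ 2,
    fun x => ?_⟩
  · simp only [LinearMap.smul_apply, real_inner_smul_left, real_inner_smul_right,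
      LinearMap.comp_apply, LinearMap.adjoint_inner_left, LinearMap.adjoint_inner_right]
  · beta_reduce
    rw [norm_sub_sq_real]
    simp only [LinearMap.smul_apply, real_inner_smul_left, LinearMap.comp_apply,
      LinearMap.adjoint_inner_left, real_inner_self_eq_norm_sq, real_inner_comm b (A x)]
    ring

/-- A symmetric operator satisfies `⟪T y, y⟫ ≤ C ‖T y‖²`. -/
theorem exists_inner_le_mul_norm_sq [FiniteDimensional ℝ E] {T : E →ₗ[ℝ] E}
    (hT : T.IsSymmetric) : ∃ C : ℝ, 0 < C ∧ ∀ y, inner ℝ (T y) y ≤ C * ‖T y‖ ^ 2 := by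
  -- By symmetry `y` may be replaced by the preimage `g (T y)`, whose norm is controlled by `‖T y‖`.
  obtain ⟨g, hg⟩ := T.rangeRestrict.exists_rightInverse_of_surjective T.range_rangeRestrict
  refine ⟨‖g.toContinuousLinearMap‖ + 1, by positivity, fun y => ?_⟩
  have h1 : T (g (T.rangeRestrict y)) = T y :=
    congrArg Subtype.val (LinearMap.congr_fun hg (T.rangeRestrict y))
  have h2 : ‖g (T.rangeRestrict y)‖ ≤ ‖g.toContinuousLinearMap‖ * ‖T y‖ :=
    g.toContinuousLinearMap.le_opNorm (T.rangeRestrict y)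
  calc inner ℝ (T y) y = inner ℝ (g (T.rangeRestrict y)) (T y) := by
        rw [← hT, h1]
    _ ≤ ‖g (T.rangeRestrict y)‖ * ‖T y‖ := real_inner_le_norm _ _
    _ ≤ ‖g.toContinuousLinearMap‖ * ‖T y‖ * ‖T y‖ := by gcongr
    _ ≤ _ := by nlinarith [sq_nonneg ‖T y‖]

/-- A symmetric form on a subspace is bounded above by the square of its gradient along the
subspace. -/
theorem exists_inner_le_mul_sq_of_mem [FiniteDimensional ℝ E] {M : E →ₗ[ℝ] E}
    (hM : M.IsSymmetric) (D : Submodule ℝ E) :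
    ∃ C : ℝ, 0 < C ∧ ∀ y ∈ D, ∀ v : E, (∀ d ∈ D, inner ℝ v d = inner ℝ (M y) d) →
      inner ℝ (M y) y ≤ C * ‖v‖ ^ 2 := by
  -- The compression of `M` to `D`; on `D` the condition on `v` says that `T y` is the projection of
  -- `v`.
  let T : D →ₗ[ℝ] D := D.orthogonalProjectionOnto.toLinearMap ∘ₗ M ∘ₗ D.subtype
  have hin : ∀ x y : D, inner ℝ (T x) y = inner ℝ (M x) (y : E) := fun x y => by
    rw [← Submodule.inner_orthogonalProjectionOnto_eq_of_mem_right y (M x)]; rfl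
  have hT : T.IsSymmetric := fun x y => by
    rw [hin, hM x y, real_inner_comm, real_inner_comm (T y), hin]
  obtain ⟨C, hC, h⟩ := exists_inner_le_mul_norm_sq hT
  refine ⟨C, hC, fun y hy v hv => ?_⟩
  have h1 := h ⟨y, hy⟩
  rw [hin] at h1
  have h2 : T ⟨y, hy⟩ = D.orthogonalProjectionOnto v := by
    refine ext_inner_right ℝ fun d => ?_
    rw [hin, Submodule.inner_orthogonalProjectionOnto_eq_of_mem_right d v, hv d d.2]
  have h3 : ‖T ⟨y, hy⟩‖ ≤ ‖v‖ := by
    rw [h2]; exact D.norm_orthogonalProjectionOnto_apply_le v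
  calc _ ≤ C * ‖T ⟨y, hy⟩‖ ^ 2 := h1
    _ ≤ _ := by gcongr

/-- The Łojasiewicz inequality with exponent `1/2` at the origin, for the quadratic function
`(d, s) ↦ ½⟪M d, d⟫ + ⟪g, d⟫ + s` on a subspace whose gradient is represented by `v`. -/
theorem exists_quadratic_le_mul_sq [FiniteDimensional ℝ E] {M : E →ₗ[ℝ] E}
    (hM : M.IsSymmetric) (g : E) (L : Submodule ℝ (E × ℝ)) :
    ∃ C : ℝ, 0 < C ∧ ∃ ε : ℝ, 0 < ε ∧ ∀ y ∈ L, ‖y.1‖ ≤ ε →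
      (1 / 2) * inner ℝ (M y.1) y.1 + inner ℝ g y.1 + y.2 ≤ 1 →
      ∀ v : E, (∀ z ∈ L, inner ℝ v z.1 = inner ℝ (M y.1 + g) z.1 + z.2) →
      (1 / 2) * inner ℝ (M y.1) y.1 + inner ℝ g y.1 + y.2 ≤ C * ‖v‖ ^ 2 := by
  -- If the linear part vanishes on `L`, only the form remains. Otherwise the gradient stays away
  -- from zero near the origin, and the bound by `1` on the value suffices.
  by_cases hl : ∀ z ∈ L, inner ℝ g z.1 + z.2 = 0
  · obtain ⟨C, hC, h⟩ := exists_inner_le_mul_sq_of_mem hM (L.map (LinearMap.fst ℝ E ℝ))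
    refine ⟨C, hC, 1, one_pos, fun y hy _ _ v hv => ?_⟩
    have h1 := h y.1 ⟨y, hy, rfl⟩ v (by
      rintro _ ⟨z, hz, rfl⟩
      have h2 := hl z hz
      have h3 := hv z hz
      rw [inner_add_left] at h3
      simp only [LinearMap.fst_apply]
      linarith)
    have h4 := hl y hy
    have h5 : 0 ≤ C * ‖v‖ ^ 2 := by positivity
    linarith
  · push Not at hl
    obtain ⟨z, hz, hne⟩ := hl
    set a : ℝ := |inner ℝ g z.1 + z.2| with ha
    have ha0 : 0 < a := abs_pos.2 hne
    have hcont : Tendsto (fun w : E => |inner ℝ (M w + g) z.1 + z.2|) (𝓝 0) (𝓝 a) := by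
      have hc : Continuous M := M.continuous_of_finiteDimensional
      have : Continuous fun w : E => |inner ℝ (M w + g) z.1 + z.2| := by fun_prop
      simpa using this.tendsto 0
    obtain ⟨ε, hε, hb⟩ := Metric.eventually_nhds_iff_ball.1
      (hcont.eventually (lt_mem_nhds (half_lt_self ha0)))
    refine ⟨((‖z.1‖ + 1) / (a / 2)) ^ 2, by positivity, ε / 2, by positivity,
      fun y _ hyε hy1 v hv => hy1.trans ?_⟩
    have h1 := hb y.1 (by simpa using lt_of_le_of_lt hyε (half_lt_self hε))
    rw [← hv z hz] at h1
    have h2 : a / 2 ≤ (‖z.1‖ + 1) * ‖v‖ := by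
      have := abs_real_inner_le_norm v z.1
      nlinarith [norm_nonneg v]
    rw [← mul_pow]
    have h3 : 1 ≤ (‖z.1‖ + 1) / (a / 2) * ‖v‖ := by
      rw [div_mul_eq_mul_div, le_div_iff₀ (by positivity)]
      linarith
    exact one_le_pow₀ h3

end Quadratic

/-! ### Subgradients on a single sheared polyhedral piece -/

section Pieces

variable {E : Type*} [NormedAddCommGroup E] [InnerProductSpace ℝ E]

theorem eventually_le_of_mem_regularSubdiff {f : E → EReal} {x v : E} {t : ℝ} (hft : f x = t)
    (hv : v ∈ regularSubdiff f x) {η : ℝ} (hη : 0 < η) :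
    ∀ᶠ z in 𝓝 x, ((t + inner ℝ v (z - x) - η * ‖z - x‖ : ℝ) : EReal) ≤ f z := by
  have hlt : ((-η : ℝ) : EReal) < liminf (fun z : E => (f z - f x -
      ((inner ℝ v (z - x) : ℝ) : EReal)) / ((‖z - x‖ : ℝ) : EReal)) (𝓝[≠] x) :=
    lt_of_lt_of_le (by exact_mod_cast neg_neg_of_pos hη) hv.2
  have hev := eventually_nhdsWithin_iff.1 (eventually_lt_of_lt_liminf hlt)
  filter_upwards [hev] with z hz
  rcases eq_or_ne z x with rfl | hne
  · simp [hft]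
  have hpos : 0 < ‖z - x‖ := norm_pos_iff.2 (sub_ne_zero.2 hne)
  have h1 := hz hne
  rw [hft] at h1
  induction hr : f z with
  | bot =>
    rw [hr, EReal.bot_sub, EReal.bot_sub, EReal.bot_div_of_pos_ne_top
      (by exact_mod_cast hpos) (EReal.coe_ne_top _)] at h1
    exact absurd h1 not_lt_bot
  | top => exact le_top
  | coe r =>
    rw [hr, ← EReal.coe_sub, ← EReal.coe_sub, ← EReal.coe_div, EReal.coe_lt_coe_iff,
      lt_div_iff₀ hpos] at h1
    rw [EReal.coe_le_coe_iff]
    linarith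

/-- Vectors of `E × ℝ` annihilated by the functionals with index in `J`. -/
def annihilated {κ : Type*} (φ : κ → E × ℝ →ₗ[ℝ] ℝ) (J : Set κ) : Submodule ℝ (E × ℝ) :=
  ⨅ j ∈ J, LinearMap.ker (φ j)

theorem mem_annihilated {κ : Type*} {φ : κ → E × ℝ →ₗ[ℝ] ℝ} {J : Set κ} {z : E × ℝ} :
    z ∈ annihilated φ J ↔ ∀ j ∈ J, φ j z = 0 := by
  simp [annihilated]

/-- The indices of the constraints that are active at `z`. -/
def activeSet {κ : Type*} (φ : κ → E × ℝ →ₗ[ℝ] ℝ) (b : κ → ℝ) (z : E × ℝ) : Set κ :=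
  {j | φ j z = b j}

variable {κ : Type*} {φ : κ → E × ℝ →ₗ[ℝ] ℝ} {b : κ → ℝ} {q : E → ℝ} {M : E →ₗ[ℝ] E} {u : E}

/-- Moving along `z` leaves active constraints unchanged, and the others have slack, so a short
segment stays in the piece and bounds `f` above by a quadratic. Comparing with the first-order lower
bound given by `v` and dividing by the step length yields the inequality. -/
theorem inner_le_of_mem_regularSubdiff [Finite κ] (hq : IsQuadraticWith q M u)
    {f : E → EReal} (hf : ∀ x (t : ℝ), (∀ j, φ j (x, t - q x) ≤ b j) → f x ≤ t)
    {x v : E} {t : ℝ} (hft : f x = t) (hx : ∀ j, φ j (x, t - q x) ≤ b j)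
    (hv : v ∈ regularSubdiff f x) {z : E × ℝ}
    (hz : z ∈ annihilated φ (activeSet φ b (x, t - q x))) :
    inner ℝ v z.1 ≤ inner ℝ (M x + u) z.1 + z.2 := by
  rw [mem_annihilated] at hz
  have hfeas : ∀ᶠ τ : ℝ in 𝓝[>] 0, ∀ j, φ j ((x, t - q x) + τ • z) ≤ b j := by
    refine eventually_all.2 fun j => ?_
    by_cases hj : j ∈ activeSet φ b (x, t - q x)
    · refine Eventually.of_forall fun τ => ?_
      rw [map_add, map_smul, hz j hj, smul_zero, add_zero]
      exact hx j
    · have hc : Continuous fun τ : ℝ => φ j ((x, t - q x) + τ • z) := by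
        simp only [map_add, map_smul]; fun_prop
      have h0 : φ j ((x, t - q x) + (0 : ℝ) • z) < b j := by
        rw [zero_smul, add_zero]; exact lt_of_le_of_ne (hx j) hj
      exact nhdsWithin_le_nhds <|
        (hc.tendsto 0).eventually (gt_mem_nhds h0) |>.mono fun _ h => h.le
  refine le_of_forall_pos_le_add fun δ hδ => ?_
  set η : ℝ := δ / (‖z.1‖ + 1) with hη
  have hη0 : 0 < η := by positivity
  have hηle : η * ‖z.1‖ ≤ δ := by
    rw [hη, div_mul_eq_mul_div, div_le_iff₀ (by positivity)]
    nlinarith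
  have hlow : ∀ᶠ τ : ℝ in 𝓝[>] 0,
      ((t + inner ℝ v (x + τ • z.1 - x) - η * ‖x + τ • z.1 - x‖ : ℝ) : EReal)
        ≤ f (x + τ • z.1) := by
    have hc : Tendsto (fun τ : ℝ => x + τ • z.1) (𝓝 0) (𝓝 x) := by
      have : Continuous fun τ : ℝ => x + τ • z.1 := by fun_prop
      simpa using this.tendsto 0
    exact nhdsWithin_le_nhds (hc.eventually (eventually_le_of_mem_regularSubdiff hft hv hη0))
  have hmain : ∀ᶠ τ : ℝ in 𝓝[>] 0, inner ℝ v z.1 ≤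
      inner ℝ (M x + u) z.1 + z.2 + δ + τ * ((1 / 2) * inner ℝ (M z.1) z.1) := by
    filter_upwards [hfeas, hlow, self_mem_nhdsWithin] with τ h1 h2 (h3 : 0 < τ)
    -- The chosen height is the one whose sheared point is `(x, t - q x) + τ • z`.
    have h4 := h2.trans (hf (x + τ • z.1) (t - q x + τ * z.2 + q (x + τ • z.1)) (by
      simpa only [Prod.smul_def, Prod.mk_add_mk, smul_eq_mul, add_sub_cancel_right] using h1))
    rw [EReal.coe_le_coe_iff, hq.expand] at h4
    simp only [add_sub_cancel_left, norm_smul, Real.norm_eq_abs, abs_of_pos h3,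
      inner_smul_right, map_smul, real_inner_smul_left] at h4
    refine le_of_mul_le_mul_left ?_ h3
    nlinarith
  have hlim : Tendsto (fun τ : ℝ => inner ℝ (M x + u) z.1 + z.2 + δ +
      τ * ((1 / 2) * inner ℝ (M z.1) z.1)) (𝓝[>] 0) (𝓝 (inner ℝ (M x + u) z.1 + z.2 + δ)) := by
    have : Continuous fun τ : ℝ => inner ℝ (M x + u) z.1 + z.2 + δ +
      τ * ((1 / 2) * inner ℝ (M z.1) z.1) := by fun_prop
    refine Tendsto.mono_left ?_ nhdsWithin_le_nhds
    simpa using this.tendsto 0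
  exact ge_of_tendsto hlim hmain

theorem inner_eq_of_mem_regularSubdiff [Finite κ] (hq : IsQuadraticWith q M u)
    {f : E → EReal} (hf : ∀ x (t : ℝ), (∀ j, φ j (x, t - q x) ≤ b j) → f x ≤ t)
    {x v : E} {t : ℝ} (hft : f x = t) (hx : ∀ j, φ j (x, t - q x) ≤ b j)
    (hv : v ∈ regularSubdiff f x) {z : E × ℝ}
    (hz : z ∈ annihilated φ (activeSet φ b (x, t - q x))) :
    inner ℝ v z.1 = inner ℝ (M x + u) z.1 + z.2 := by
  refine le_antisymm (inner_le_of_mem_regularSubdiff hq hf hft hx hv hz) ?_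
  have := inner_le_of_mem_regularSubdiff hq hf hft hx hv (neg_mem hz)
  simp only [Prod.fst_neg, Prod.snd_neg, inner_neg_right] at this
  linarith

/-- Constraints that are strict at a point remain so nearby. -/
theorem eventually_constraints [FiniteDimensional ℝ E] [Finite κ] (φ : κ → E × ℝ →ₗ[ℝ] ℝ)
    (b : κ → ℝ) (hq : Continuous q) (x : E) (t : ℝ) :
    ∀ᶠ p : E × ℝ in 𝓝 (x, t), ∀ j,
      (φ j (x, t - q x) < b j → φ j (p.1, p.2 - q p.1) < b j) ∧
      (b j < φ j (x, t - q x) → b j < φ j (p.1, p.2 - q p.1)) := by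
  refine eventually_all.2 fun j => ?_
  have hφ : Continuous (φ j) := (φ j).continuous_of_finiteDimensional
  have hc : Continuous fun p : E × ℝ => φ j (p.1, p.2 - q p.1) := by fun_prop
  refine Eventually.and ?_ ?_
  · by_cases h : φ j (x, t - q x) < b j
    · exact ((hc.tendsto (x, t)).eventually (gt_mem_nhds h)).mono fun _ h _ => h
    · exact Eventually.of_forall fun _ h' => absurd h' h
  · by_cases h : b j < φ j (x, t - q x)
    · exact ((hc.tendsto (x, t)).eventually (lt_mem_nhds h)).mono fun _ h _ => h
    · exact Eventually.of_forall fun _ h' => absurd h' h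

end Pieces

/-! ### Finite unions of pieces and limiting subgradients -/

section Family

variable {E : Type*} [NormedAddCommGroup E] [InnerProductSpace ℝ E]
  {ι : Type*} {κ : ι → Type*} {φ : ∀ i, κ i → E × ℝ →ₗ[ℝ] ℝ} {b : ∀ i, κ i → ℝ}
  {q : ι → E → ℝ} {M : ι → E →ₗ[ℝ] E} {u : ι → E} {f : E → EReal}

/-- Some piece contains infinitely many of the approximating points. Constraints slack at the limit
are slack nearby, so active sets can only grow in the limit; the limit's annihilated directions are
thus admissible along the sequence, and the linear identity passes to the limit. -/
theorem exists_inner_eq_of_mem_subdiff [FiniteDimensional ℝ E] [Finite ι] [∀ i, Finite (κ i)]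
    (hq : ∀ i, IsQuadraticWith (q i) (M i) (u i))
    (hf : ∀ x (t : ℝ), f x ≤ t ↔ ∃ i, ∀ j, φ i j (x, t - q i x) ≤ b i j)
    (hbot : ∀ x, f x ≠ ⊥) {x v : E} {t : ℝ} (hft : f x = t) (hv : v ∈ subdiff f x) :
    ∃ i, (∀ j, φ i j (x, t - q i x) ≤ b i j) ∧
      ∀ z ∈ annihilated (φ i) (activeSet (φ i) (b i) (x, t - q i x)),
        inner ℝ v z.1 = inner ℝ (M i x + u i) z.1 + z.2 := by
  obtain ⟨-, y, w, hy, hfy, hw, hmem⟩ := hv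
  set s : ℕ → ℝ := fun n => (f (y n)).toReal with hs
  have hfs : ∀ n, f (y n) = s n := fun n =>
    (EReal.coe_toReal (ne_of_lt (hmem n).1) (hbot _)).symm
  have hst : Tendsto s atTop (𝓝 t) := by
    rw [hft] at hfy
    exact (EReal.tendsto_toReal (EReal.coe_ne_top t) (EReal.coe_ne_bot t)).comp hfy
  obtain ⟨i, hi⟩ : ∃ i, ∃ᶠ n in atTop, ∀ j, φ i j (y n, s n - q i (y n)) ≤ b i j := by
    by_contra! hcon
    obtain ⟨n, hn⟩ := (eventually_all.2 hcon).exists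
    obtain ⟨i, hi⟩ := (hf (y n) (s n)).1 (hfs n).le
    obtain ⟨j, hj⟩ := hn i
    exact absurd (hi j) (not_le.2 hj)
  have hev := (hy.prodMk_nhds hst).eventually
    (eventually_constraints (φ i) (b i) (hq i).continuous x t)
  refine ⟨i, fun j => ?_, fun z hz => ?_⟩
  · obtain ⟨n, hn, hn'⟩ := (hi.and_eventually hev).exists
    by_contra! hcon
    exact absurd (hn j) (not_le.2 ((hn' j).2 hcon))
  · have hfreq : ∃ᶠ n in atTop,
        inner ℝ (w n) z.1 - (inner ℝ (M i (y n) + u i) z.1 + z.2) ∈ ({0} : Set ℝ) := by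
      refine (hi.and_eventually hev).mono fun n hn => ?_
      refine sub_eq_zero.2 (inner_eq_of_mem_regularSubdiff (hq i)
        (fun x t h => (hf x t).2 ⟨i, h⟩) (hfs n) hn.1 (hmem n) ?_)
      rw [mem_annihilated] at hz ⊢
      intro j hj
      refine hz j ?_
      rcases lt_trichotomy (φ i j (x, t - q i x)) (b i j) with h | h | h
      · exact absurd hj (ne_of_lt ((hn.2 j).1 h))
      · exact h
      · exact absurd hj (ne_of_gt ((hn.2 j).2 h))
    have hlim : Tendsto (fun n => inner ℝ (w n) z.1 - (inner ℝ (M i (y n) + u i) z.1 + z.2))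
        atTop (𝓝 (inner ℝ v z.1 - (inner ℝ (M i x + u i) z.1 + z.2))) := by
      have hM : Tendsto (fun n => M i (y n)) atTop (𝓝 (M i x)) :=
        ((M i).continuous_of_finiteDimensional.tendsto x).comp hy
      exact (hw.inner tendsto_const_nhds).sub
        (((hM.add_const _).inner tendsto_const_nhds).add_const _)
    exact sub_eq_zero.1 (isClosed_singleton.mem_of_frequently_of_tendsto hfreq hlim)

/-- The squared-norm form of the Łojasiewicz inequality for piecewise quadratic functions. -/
theorem exists_sub_le_mul_norm_sq [FiniteDimensional ℝ E] [Finite ι] [∀ i, Finite (κ i)]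
    (hq : ∀ i, IsQuadraticWith (q i) (M i) (u i))
    (hf : ∀ x (t : ℝ), f x ≤ t ↔ ∃ i, ∀ j, φ i j (x, t - q i x) ≤ b i j)
    (hbot : ∀ x, f x ≠ ⊥) (x₀ : E) (t₀ : ℝ) :
    ∃ C : ℝ, 0 < C ∧ ∃ ε : ℝ, 0 < ε ∧ ∃ ν : ℝ, 0 < ν ∧ ∀ (x : E) (t : ℝ), f x = t →
      ‖x - x₀‖ ≤ ε → t₀ < t → t < t₀ + ν → ∀ v ∈ subdiff f x, t - t₀ ≤ C * ‖v‖ ^ 2 := by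
  -- All index sets are considered, so that the constants do not depend on which constraints are
  -- active at `x`.
  choose C hC ε hε hmain using fun (p : Σ i, Set (κ i)) =>
    exists_quadratic_le_mul_sq (hq p.1).1 (M p.1 x₀ + u p.1) (annihilated (φ p.1) p.2)
  obtain ⟨C', hC'⟩ := (Set.finite_range C).bddAbove
  obtain ⟨e, he, hee⟩ : ∃ e : ℝ, 0 < e ∧ ∀ p, e ≤ ε p := by
    have : ∀ᶠ e : ℝ in 𝓝[>] 0, ∀ p, e ≤ ε p := eventually_all.2 fun p =>
      nhdsWithin_le_nhds (eventually_le_nhds (hε p))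
    obtain ⟨e, h1, h2⟩ := (this.and self_mem_nhdsWithin).exists
    exact ⟨e, h2, h1⟩
  have hev := eventually_all.2 fun i =>
    eventually_constraints (φ i) (b i) (hq i).continuous x₀ t₀
  obtain ⟨δ, hδ, hball⟩ := Metric.eventually_nhds_iff_ball.1 hev
  -- The bounds `δ / 2` and `δ` keep `(x, t)` in the ball; the bound `1` on `t - t₀` is the value
  -- bound of the quadratic lemma.
  refine ⟨max C' 1, by positivity, min e (δ / 2), by positivity, min 1 δ, by positivity,
    fun x t hft hx ht ht' v hv => ?_⟩
  obtain ⟨i, hi, hvi⟩ := exists_inner_eq_of_mem_subdiff hq hf hbot hft hv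
  have hnear := hball (x, t) (by
    rw [Metric.mem_ball, Prod.dist_eq, max_lt_iff, dist_eq_norm, Real.dist_eq, abs_lt]
    have h1 := hx.trans (min_le_right _ _)
    have h2 := min_le_right 1 δ
    refine ⟨?_, ?_, ?_⟩ <;> simp only <;> linarith) i
  set J := activeSet (φ i) (b i) (x, t - q i x) with hJ
  set y : E × ℝ := (x, t - q i x) - (x₀, t₀ - q i x₀) with hy
  have hyL : y ∈ annihilated (φ i) J := by
    refine mem_annihilated.2 fun j hj => ?_
    have hj' : φ i j (x, t - q i x) = b i j := hj
    -- The base point need not lie in piece `i`, so strict inequality has to be excluded on both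
    -- sides.
    have : φ i j (x₀, t₀ - q i x₀) = b i j := by
      rcases lt_trichotomy (φ i j (x₀, t₀ - q i x₀)) (b i j) with h | h | h
      · exact absurd hj' (ne_of_lt ((hnear j).1 h))
      · exact h
      · exact absurd hj' (ne_of_gt ((hnear j).2 h))
    rw [hy, map_sub, hj', this, sub_self]
  have hval : (1 / 2) * inner ℝ (M i y.1) y.1 + inner ℝ (M i x₀ + u i) y.1 + y.2 = t - t₀ := by
    have h := (hq i).expand x₀ (x - x₀)
    rw [add_sub_cancel] at h
    simp only [hy, Prod.fst_sub, Prod.snd_sub]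
    linarith
  have hfin := hmain ⟨i, J⟩ y hyL ((hx.trans (min_le_left _ _)).trans (hee _))
    (by simp only; rw [hval]; linarith [min_le_left 1 δ]) v (fun z hz => by
      rw [hvi z hz, ← add_assoc, ← map_add]
      simp [hy])
  simp only at hfin
  rw [hval] at hfin
  refine hfin.trans ?_
  gcongr
  exact (hC' ⟨_, rfl⟩).trans (le_max_left _ _)

end Family

/-! ### From the squared-norm inequality to the KL exponent -/

section Exponent

variable {E : Type*} [NormedAddCommGroup E] [InnerProductSpace ℝ E]

/-- The KL inequality with exponent `1/2` gives the KL property with desingularizing function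
`s ↦ (2 / c) √s`. -/
theorem HasKLExponentAt.hasKLProperty {f : E → EReal} (hbot : ∀ x, f x ≠ ⊥) {x₀ : E}
    (h : HasKLExponentAt f (1 / 2) x₀) : HasKLProperty f x₀ := by
  obtain ⟨hx₀, c, hc, ε, hε, ν, hν, h⟩ := h
  obtain ⟨t₀, ht₀⟩ : ∃ t : ℝ, f x₀ = t :=
    ⟨_, (EReal.coe_toReal (ne_of_lt hx₀.some_mem.1) (hbot _)).symm⟩
  have hderiv : ∀ s : ℝ, 0 < s → deriv (fun s => 2 / c * √s) s = 1 / (c * √s) := fun s hs => by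
    rw [((Real.hasDerivAt_sqrt hs.ne').const_mul (2 / c)).deriv]
    field_simp
  have hconv : Convex ℝ {s : ℝ | 0 ≤ s ∧ (s : EReal) < ν} := by
    refine Set.OrdConnected.convex ⟨fun a ha b hb s hs => ⟨ha.1.trans hs.1, ?_⟩⟩
    exact lt_of_le_of_lt (EReal.coe_le_coe_iff.2 hs.2) hb.2
  refine ⟨hx₀, Metric.closedBall x₀ ε, Metric.closedBall_mem_nhds _ hε, ν, hν,
    fun s => 2 / c * √s, by fun_prop, ?_, fun s _ _ => by positivity, by simp, ?_, ?_, ?_⟩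
  · have := (Real.strictConcaveOn_sqrt.concaveOn.subset (fun s hs => hs.1) hconv).smul
      (c := 2 / c) (by positivity)
    simpa only [smul_eq_mul] using this
  · exact contDiffOn_const.mul (ContDiffOn.sqrt contDiffOn_id fun s hs => hs.1.ne')
  · intro s hs _
    rw [hderiv s hs]
    positivity
  · intro x hx hlt hltν
    have htop : f x ≠ ⊤ := ne_top_of_lt hltν
    obtain ⟨t, ht⟩ : ∃ t : ℝ, f x = t := ⟨_, (EReal.coe_toReal htop (hbot _)).symm⟩
    have h1 := h x (by simpa [dist_eq_norm] using hx) hlt hltν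
    rw [ht, ht₀, EReal.coe_lt_coe_iff] at hlt
    rw [ht, ht₀, ← EReal.coe_sub, EReal.toReal_coe, ← Real.sqrt_eq_rpow] at h1
    rw [ht, ht₀, ← EReal.coe_sub, EReal.toReal_coe, hderiv _ (sub_pos.2 hlt)]
    have hs : 0 < c * √(t - t₀) := mul_pos hc (Real.sqrt_pos.2 (sub_pos.2 hlt))
    calc (1 : ENNReal) = ENNReal.ofReal (1 / (c * √(t - t₀))) *
          ENNReal.ofReal (c * √(t - t₀)) := by
          rw [← ENNReal.ofReal_mul (by positivity), one_div_mul_cancel hs.ne',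
            ENNReal.ofReal_one]
      _ ≤ _ := by gcongr

/-- A function whose epigraph is a finite union of polyhedral sets, each sheared by a quadratic
function, is a KL function with an exponent of `1/2`. -/
theorem isKLFunctionWithExponent_of_epigraph [FiniteDimensional ℝ E] {ι : Type*} [Finite ι]
    {f : E → EReal} {q : ι → E → ℝ} {C : ι → Set (E × ℝ)} (hproper : IsProper f)
    (hq : ∀ i, IsQuadratic (q i)) (hC : ∀ i, IsPolyhedralSet (C i))
    (hf : ∀ x (t : ℝ), f x ≤ t ↔ ∃ i, (x, t - q i x) ∈ C i) :
    IsKLFunctionWithExponent f (1 / 2) := by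
  choose M u hq using hq
  choose k φ b hC using hC
  simp only [hC, Set.mem_ofPred_eq] at hf
  have hbot := hproper.1
  have hlsc : LowerSemicontinuous f := by
    have hreal : ∀ t : ℝ, IsClosed {x | f x ≤ t} := fun t => by
      have : {x | f x ≤ t} = ⋃ i, ⋂ j, {x | φ i j (x, t - q i x) ≤ b i j} := by
        ext x; simp [hf]
      rw [this]
      refine isClosed_iUnion_of_finite fun i => isClosed_iInter fun j => ?_
      have h1 : Continuous (φ i j) := (φ i j).continuous_of_finiteDimensional
      have h2 := (hq i).continuous
      exact isClosed_le (by fun_prop) continuous_const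
    refine lowerSemicontinuous_iff_isClosed_preimage.2 fun y => ?_
    induction y with
    | bot =>
      have : f ⁻¹' Set.Iic ⊥ = ∅ :=
        Set.eq_empty_of_forall_notMem fun x hx => hbot x (le_bot_iff.1 hx)
      rw [this]; exact isClosed_empty
    | top => simp
    | coe t => exact hreal t
  have hexp : ∀ x₀ ∈ domSubdiff f, HasKLExponentAt f (1 / 2) x₀ := by
    intro x₀ hx₀
    obtain ⟨t₀, ht₀⟩ : ∃ t : ℝ, f x₀ = t :=
      ⟨_, (EReal.coe_toReal (ne_of_lt hx₀.some_mem.1) (hbot _)).symm⟩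
    obtain ⟨K, hK, ε, hε, ν, hν, h⟩ := exists_sub_le_mul_norm_sq hq hf hbot x₀ t₀
    refine ⟨hx₀, 1 / √K, by positivity, ε, hε, ν, by exact_mod_cast hν,
      fun x hx hlt hltν => Metric.le_infEDist.2 fun v hv => ?_⟩
    obtain ⟨t, ht⟩ : ∃ t : ℝ, f x = t :=
      ⟨_, (EReal.coe_toReal (ne_of_lt hv.1) (hbot _)).symm⟩
    rw [ht, ht₀] at hlt hltν ⊢
    rw [← EReal.coe_add, EReal.coe_lt_coe_iff] at hltν
    have h1 := h x t ht hx (EReal.coe_lt_coe_iff.1 hlt) hltν v hv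
    rw [← EReal.coe_sub, EReal.toReal_coe, ← Real.sqrt_eq_rpow, edist_dist, dist_zero_left]
    refine ENNReal.ofReal_le_ofReal ?_
    rw [one_div_mul_eq_div, div_le_iff₀ (Real.sqrt_pos.2 hK)]
    calc √(t - t₀) ≤ √(K * ‖v‖ ^ 2) := Real.sqrt_le_sqrt h1
      _ = ‖v‖ * √K := by rw [Real.sqrt_mul hK.le, Real.sqrt_sq (norm_nonneg v), mul_comm]
  exact ⟨by norm_num, by norm_num,
    ⟨hproper, hlsc, fun x hx => (hexp x hx).hasKLProperty hbot⟩, hexp⟩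

end Exponent

/-! ### Minima of quadratic plus polyhedral functions -/

section Minimum

theorem isQuadratic_quad {n : ℕ} {M : Matrix (Fin n) (Fin n) ℝ} (hM : M.IsSymm)
    (u : EuclideanSpace ℝ (Fin n)) (β : ℝ) : IsQuadratic (quad M u β) := by
  have hin : ∀ x y : EuclideanSpace ℝ (Fin n), inner ℝ x y = x.ofLp ⬝ᵥ y.ofLp := fun x y => by
    rw [real_inner_comm, EuclideanSpace.inner_eq_star_dotProduct, star_trivial]
  refine ⟨M.toEuclideanLin, u, fun x y => ?_, β, fun x => ?_⟩
  · rw [hin, hin]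
    simp only [Matrix.toEuclideanLin, Matrix.ofLp_toLpLin, Matrix.toLin'_apply]
    rw [Matrix.dotProduct_mulVec, ← Matrix.mulVec_transpose, hM.eq]
  · rw [hin, hin, quad, Matrix.toEuclideanLin, Matrix.ofLp_toLpLin, Matrix.toLin'_apply, dotProduct_comm x.ofLp]

theorem isKLFunctionWithExponent_minQuadPlus {n r : ℕ} (hr : 1 ≤ r)
    {M : Fin r → Matrix (Fin n) (Fin n) ℝ} (hM : ∀ i, (M i).IsSymm)
    (u : Fin r → EuclideanSpace ℝ (Fin n)) (β : Fin r → ℝ)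
    {P : Fin r → EuclideanSpace ℝ (Fin n) → EReal} (hP : ∀ i, IsProper (P i))
    (hpoly : ∀ i, IsPolyhedralFun (P i)) :
    IsKLFunctionWithExponent (minQuadPlus M u β P) (1 / 2) := by
  have : Nonempty (Fin r) := ⟨⟨0, hr⟩⟩
  have hmin : ∀ x, ∃ i, minQuadPlus M u β P x = ((quad (M i) (u i) (β i) x : ℝ) : EReal) + P i x :=
    fun x => (exists_eq_ciInf_of_finite
      (f := fun i => ((quad (M i) (u i) (β i) x : ℝ) : EReal) + P i x)).imp fun _ h => h.symm
  have hle : ∀ x i, minQuadPlus M u β P x ≤ ((quad (M i) (u i) (β i) x : ℝ) : EReal) + P i x :=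
    fun x i => iInf_le _ i
  refine isKLFunctionWithExponent_of_epigraph
    (q := fun i => quad (M i) (u i) (β i)) (C := fun i => {p | P i p.1 ≤ (p.2 : EReal)})
    ⟨fun x => ?_, ?_⟩ (fun i => isQuadratic_quad (hM i) _ _) hpoly fun x t => ?_
  · obtain ⟨i, hi⟩ := hmin x
    rw [hi, Ne, EReal.add_eq_bot_iff, not_or]
    exact ⟨EReal.coe_ne_bot _, (hP i).1 x⟩
  · obtain ⟨i⟩ := this
    obtain ⟨x, hx⟩ := (hP i).2
    exact ⟨x, (hle x i).trans_lt (EReal.add_lt_top (EReal.coe_ne_top _) (ne_of_lt hx))⟩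
  · have hshift : ∀ i, P i x ≤ ((t - quad (M i) (u i) (β i) x : ℝ) : EReal) ↔
        ((quad (M i) (u i) (β i) x : ℝ) : EReal) + P i x ≤ t := fun i => by
      rw [EReal.coe_sub, EReal.le_sub_iff_add_le (.inl (EReal.coe_ne_bot _))
        (.inl (EReal.coe_ne_top _)), add_comm]
    simp only [Set.mem_ofPred_eq, hshift]
    refine ⟨fun h => (hmin x).imp fun i hi => hi.ge.trans h, fun ⟨i, hi⟩ => (hle x i).trans hi⟩

end Minimum

/-! ### Least squares with SCAD and MCP penalties -/

section Penalty

/-- A function on `ℝ` that agrees with a quadratic polynomial on each of finitely many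
intervals `{t | a k 0 * t ≤ c k 0 ∧ a k 1 * t ≤ c k 1}` covering `ℝ`. -/
def IsPiecewiseQuadratic (ρ : ℝ → ℝ) : Prop :=
  ∃ (K : ℕ) (a c : Fin K → Fin 2 → ℝ) (α β γ : Fin K → ℝ),
    (∀ t, ∃ k, ∀ j, a k j * t ≤ c k j) ∧
    ∀ k t, (∀ j, a k j * t ≤ c k j) → ρ t = α k * t ^ 2 + β k * t + γ k

/-- Adjacent formulas agree at the breakpoints, which allows the closed intervals required by
polyhedral pieces. -/
theorem scad_of_mem_Icc {lam θ t : ℝ} (h1 : lam ≤ |t|) (h2 : |t| ≤ θ * lam)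
    (hθ : 0 < 2 * (θ - 1)) :
    scad lam θ t = (-t ^ 2 + 2 * θ * lam * |t| - lam ^ 2) / (2 * (θ - 1)) := by
  unfold scad
  split_ifs with h
  · rw [← sq_abs t, le_antisymm h h1, eq_div_iff hθ.ne']
    ring
  · rfl

theorem scad_of_le {lam θ t : ℝ} (hlt : lam < θ * lam) (h : θ * lam ≤ |t|)
    (hθ : 0 < 2 * (θ - 1)) : scad lam θ t = (θ + 1) * lam ^ 2 / 2 := by
  rcases h.eq_or_lt with h | h
  · rw [scad_of_mem_Icc (hlt.le.trans h.le) h.ge hθ, ← sq_abs t, ← h, div_eq_iff hθ.ne']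
    ring
  · rw [scad, if_neg (not_le.2 (hlt.trans h)), if_neg (not_le.2 h)]

theorem mcp_of_le {lam θ t : ℝ} (h : θ * lam ≤ |t|) (hθ : 0 < θ) :
    mcp lam θ t = θ * lam ^ 2 / 2 := by
  unfold mcp
  split_ifs with h'
  · rw [← sq_abs t, le_antisymm h' h]
    field_simp
    ring
  · rfl

theorem isPiecewiseQuadratic_scad {lam θ : ℝ} (hlam : 0 < lam) (hθ : 2 < θ) :
    IsPiecewiseQuadratic (scad lam θ) := by
  have hθ1 : 0 < 2 * (θ - 1) := by linarith
  have hlt : lam < θ * lam := by nlinarith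
  -- Intervals from left to right, split at `0` to resolve `|t|`; a half-line repeats its single
  -- inequality.
  refine ⟨6, ![![1, 1], ![-1, 1], ![-1, 1], ![-1, 1], ![-1, 1], ![-1, -1]],
    ![![-(θ * lam), -(θ * lam)], ![θ * lam, -lam], ![lam, 0], ![0, lam], ![-lam, θ * lam],
      ![-(θ * lam), -(θ * lam)]],
    ![0, -1 / (2 * (θ - 1)), 0, 0, -1 / (2 * (θ - 1)), 0],
    ![0, -(2 * θ * lam) / (2 * (θ - 1)), -lam, lam, 2 * θ * lam / (2 * (θ - 1)), 0],
    ![(θ + 1) * lam ^ 2 / 2, -lam ^ 2 / (2 * (θ - 1)), 0, 0, -lam ^ 2 / (2 * (θ - 1)),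
      (θ + 1) * lam ^ 2 / 2], fun t => ?_, fun k t h => ?_⟩
  · simp only [Fin.exists_fin_succ, Fin.forall_fin_two]
    simp
    grind
  · fin_cases k <;> simp [Fin.forall_fin_two] at h ⊢
    · exact scad_of_le hlt (by rw [abs_of_neg] <;> linarith) hθ1
    · rw [scad_of_mem_Icc (by rw [abs_of_neg] <;> linarith) (by rw [abs_of_neg] <;> linarith) hθ1,
        abs_of_neg (by linarith)]
      ring
    · rw [scad, abs_of_nonpos h.2, if_pos h.1, mul_neg]
    · rw [scad, abs_of_nonneg h.1, if_pos h.2]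
    · rw [scad_of_mem_Icc (by rw [abs_of_pos] <;> linarith) (by rw [abs_of_pos] <;> linarith) hθ1,
        abs_of_pos (by linarith)]
      ring
    · exact scad_of_le hlt (by rw [abs_of_pos] <;> linarith) hθ1

theorem isPiecewiseQuadratic_mcp {lam θ : ℝ} (hlam : 0 < lam) (hθ : 0 < θ) :
    IsPiecewiseQuadratic (mcp lam θ) := by
  have hpos : 0 < θ * lam := by positivity
  refine ⟨4, ![![1, 1], ![-1, 1], ![-1, 1], ![-1, -1]],
    ![![-(θ * lam), -(θ * lam)], ![θ * lam, 0], ![0, θ * lam], ![-(θ * lam), -(θ * lam)]],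
    ![0, -1 / (2 * θ), -1 / (2 * θ), 0], ![0, -lam, lam, 0],
    ![θ * lam ^ 2 / 2, 0, 0, θ * lam ^ 2 / 2], fun t => ?_, fun k t h => ?_⟩
  · simp only [Fin.exists_fin_succ, Fin.forall_fin_two]
    simp
    grind
  · fin_cases k <;> simp [Fin.forall_fin_two] at h ⊢
    · exact mcp_of_le (by rw [abs_of_neg] <;> linarith) hθ
    · rw [mcp, abs_of_nonpos h.2, if_pos h.1]
      ring
    · rw [mcp, abs_of_nonneg h.1, if_pos h.2]
      ring
    · exact mcp_of_le (by rw [abs_of_pos] <;> linarith) hθ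

theorem isPolyhedralSet_setOf {V ι : Type*} [AddCommGroup V] [Module ℝ V] [Finite ι]
    (φ : ι → V →ₗ[ℝ] ℝ) (b : ι → ℝ) : IsPolyhedralSet {z | ∀ i, φ i z ≤ b i} := by
  obtain ⟨n, ⟨e⟩⟩ := Finite.exists_equiv_fin ι
  refine ⟨n, fun j => φ (e.symm j), fun j => b (e.symm j), ?_⟩
  ext z
  exact e.symm.forall_congr_right.symm

/-- A map `σ` picks one interval per coordinate. On the resulting box the objective is the quadratic
`q σ`, and finitely many such boxes cover the space. -/
theorem isKLFunctionWithExponent_regLeastSquares {m n : ℕ} (A : Matrix (Fin m) (Fin n) ℝ)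
    (b : EuclideanSpace ℝ (Fin m)) {ρ : ℝ → ℝ} (hρ : IsPiecewiseQuadratic ρ) :
    IsKLFunctionWithExponent (regLeastSquares A b ρ) (1 / 2) := by
  obtain ⟨K, a, c, α, β, γ, hcover, hρ⟩ := hρ
  let coord (i : Fin n) : EuclideanSpace ℝ (Fin n) →ₗ[ℝ] ℝ := (EuclideanSpace.proj i).toLinearMap
  let q (σ : Fin n → Fin K) (x : EuclideanSpace ℝ (Fin n)) : ℝ :=
    (1 / 2 : ℝ) * ‖WithLp.toLp 2 (A *ᵥ x.ofLp) - b‖ ^ 2 +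
      ∑ i, (α (σ i) * x i ^ 2 + β (σ i) * x i + γ (σ i))
  let C (σ : Fin n → Fin K) : Set (EuclideanSpace ℝ (Fin n) × ℝ) :=
    -- The index `none` encodes `0 ≤ p.2`; the others cut out the box.
    {p | ∀ o : Option (Fin n × Fin 2), (o.elim (-LinearMap.snd ℝ _ ℝ)
      fun ij => (a (σ ij.1) ij.2 • coord ij.1) ∘ₗ LinearMap.fst ℝ _ ℝ) p ≤
        o.elim 0 fun ij => c (σ ij.1) ij.2}
  have hC : ∀ σ p, p ∈ C σ ↔ 0 ≤ p.2 ∧ ∀ i j, a (σ i) j * p.1 i ≤ c (σ i) j := fun σ p => by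
    simp [C, coord, Option.forall]
  refine isKLFunctionWithExponent_of_epigraph (q := q) (C := C)
    ⟨fun x => EReal.coe_ne_bot _, 0, EReal.coe_lt_top _⟩ (fun σ => ?_)
    (fun σ => isPolyhedralSet_setOf _ _) fun x t => ?_
  · refine ((IsQuadratic.norm_sub_sq A.toEuclideanLin b).const_mul (1 / 2)).add
      (.sum _ fun i => .add (.add (.const_mul ?_ _) (.const_mul ?_ _)) (.const _))
    · have := IsQuadratic.norm_sub_sq (coord i) 0
      simpa [coord] using this
    · have := IsQuadratic.linear (EuclideanSpace.single i (1 : ℝ))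
      simpa [EuclideanSpace.inner_single_left] using this
  · have hval : ∀ σ : Fin n → Fin K, (∀ i j, a (σ i) j * x i ≤ c (σ i) j) →
        regLeastSquares A b ρ x = (q σ x : ℝ) := fun σ h => by
      simp only [regLeastSquares, q]
      rw [Finset.sum_congr rfl fun i _ => hρ (σ i) (x i) (h i)]
    simp only [hC, sub_nonneg]
    constructor
    · intro h
      choose σ hσ using fun i => hcover (x i)
      rw [hval σ hσ, EReal.coe_le_coe_iff] at h
      exact ⟨σ, h, hσ⟩
    · rintro ⟨σ, h, hσ⟩
      rw [hval σ hσ, EReal.coe_le_coe_iff]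
      exact h

end Penalty

end KL

theorem mainTheorem4 :
    (∀ (n r : ℕ), 1 ≤ r →
      ∀ (M : Fin r → Matrix (Fin n) (Fin n) ℝ) (u : Fin r → EuclideanSpace ℝ (Fin n))
        (β : Fin r → ℝ) (P : Fin r → EuclideanSpace ℝ (Fin n) → EReal),
      (∀ i, (M i).IsSymm) →
      (∀ i, KL.IsProper (P i) ∧ KL.IsClosedFun (P i) ∧ KL.IsPolyhedralFun (P i)) →
      ContinuousOn (KL.minQuadPlus M u β P) (KL.domSubdiff (KL.minQuadPlus M u β P)) →
      KL.IsKLFunctionWithExponent (KL.minQuadPlus M u β P) (1 / 2)) ∧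
    (∀ (m n : ℕ) (A : Matrix (Fin m) (Fin n) ℝ) (b : EuclideanSpace ℝ (Fin m)) (lam θ : ℝ),
      0 < lam → 2 < θ →
      KL.IsKLFunctionWithExponent (KL.regLeastSquares A b (KL.scad lam θ)) (1 / 2)) ∧
    (∀ (m n : ℕ) (A : Matrix (Fin m) (Fin n) ℝ) (b : EuclideanSpace ℝ (Fin m)) (lam θ : ℝ),
      0 < lam → 0 < θ →
      KL.IsKLFunctionWithExponent (KL.regLeastSquares A b (KL.mcp lam θ)) (1 / 2)) := by 
  exact ⟨fun n r hr M u β P hM hP _ => KL.isKLFunctionWithExponent_minQuadPlus hr hM u β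
      (fun i => (hP i).1) (fun i => (hP i).2.2),
    fun m n A b lam θ hlam hθ => KL.isKLFunctionWithExponent_regLeastSquares A b
      (KL.isPiecewiseQuadratic_scad hlam hθ),
    fun m n A b lam θ hlam hθ => KL.isKLFunctionWithExponent_regLeastSquares A b
      (KL.isPiecewiseQuadratic_mcp hlam hθ)⟩
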